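/- **Theorem.** Call a polynomial $f\in\mathbb{R}[x]$ *hyperbolic* if all of its complex zeros are real; the zero polynomial is also deemed hyperbolic. A sequence of real numbers $\{a_n\}_{n=0}^{\infty}$ is a *classic multiplier sequence* (a multiplier sequence for the standard basis $1,x,x^2,\dots$) if there is a linear operator $T:\mathbb{R}[x]\to\mathbb{R}[x]$ that maps every hyperbolic polynomial to a hyperbolic polynomial and satisfies $T[x^n]=a_nx^n$ for every integer $n\ge 0$. Let $A,B,C\in\mathbb{R}$. Then $\{An(n-1)+Bn+C\}_{n=0}^{\infty}$ is a classic multiplier sequence if and only if $A,B,C$ are of the same sign (that is, either $A,B,C\ge 0$ or $A,B,C\le 0$) and $$0\le B^2-4AC.$$ -/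

import Mathlib

open Polynomial

/-- A real polynomial is hyperbolic if all of its complex zeros are real; the zero polynomial is
deemed to be hyperbolic. -/
def IsHyperbolic (f : ℝ[X]) : Prop :=
  f = 0 ∨ ∀ z : ℂ, aeval z f = 0 → z.im = 0

/-- A linear operator on `ℝ[X]` preserves hyperbolicity if it maps hyperbolic polynomials to
hyperbolic polynomials. -/
def PreservesHyperbolicity (T : ℝ[X] →ₗ[ℝ] ℝ[X]) : Prop :=
  ∀ f : ℝ[X], IsHyperbolic f → IsHyperbolic (T f)

/-- `a` is a `P`-multiplier sequence, for a basis `P` of `ℝ[X]`, if some hyperbolicity preserver `T`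
satisfies `T (P n) = a n • P n` for all `n`. -/
def IsMultiplierSequence (P : Module.Basis ℕ ℝ ℝ[X]) (a : ℕ → ℝ) : Prop :=
  ∃ T : ℝ[X] →ₗ[ℝ] ℝ[X], PreservesHyperbolicity T ∧ ∀ n : ℕ, T (P n) = a n • P n

/-- A classic multiplier sequence is a multiplier sequence for the standard basis `1, x, x ^ 2, …`
of `ℝ[X]`. -/
def IsClassicMultiplierSequence (a : ℕ → ℝ) : Prop :=
  IsMultiplierSequence (Polynomial.basisMonomials ℝ) a

/-- Three real numbers are of the same sign (zero being compatible with both signs). -/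
def SameSign (a b c : ℝ) : Prop :=
  (0 ≤ a ∧ 0 ≤ b ∧ 0 ≤ c) ∨ (a ≤ 0 ∧ b ≤ 0 ∧ c ≤ 0)

/-! Only `quadraticEulerOp A B C` can realize the sequence, so the question is when it preserves
hyperbolicity. Freezing a nonreal `x` and putting `g(u) = f(xu)` turns its value at `x` into `A g''
+ B g' + C g` at `u = 1`. If `A t² + B t + C` splits into real linear factors with nonnegative
coefficients, a Gauss–Lucas argument (`eval_combination_ne_zero`), applied once per factor, makes
this nonzero. Conversely, `(1 + x)^n` for large `n` forces the discriminant condition, and even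
polynomials with simple real zeros, times `x^k`, force the signs. -/

/-- The differential operator `A x² D² + B x D + C` on real polynomials. -/
noncomputable def quadraticEulerOp (A B C : ℝ) : ℝ[X] →ₗ[ℝ] ℝ[X] where
  toFun f := Polynomial.C A * X ^ 2 * derivative (derivative f) + Polynomial.C B * X * derivative f
    + Polynomial.C C * f
  map_add' f g := by simp only [derivative_add]; ring
  map_smul' c f := by simp only [derivative_smul, RingHom.id_apply]; simp only [smul_eq_C_mul]; ring

theorem quadraticEulerOp_apply (A B C : ℝ) (f : ℝ[X]) :
    quadraticEulerOp A B C f = Polynomial.C A * X ^ 2 * derivative (derivative f)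
      + Polynomial.C B * X * derivative f + Polynomial.C C * f := rfl

theorem quadraticEulerOp_X_pow (A B C : ℝ) (n : ℕ) :
    quadraticEulerOp A B C (X ^ n) = (A * (n : ℝ) * ((n : ℝ) - 1) + B * (n : ℝ) + C) • X ^ n := by
  rw [quadraticEulerOp_apply, smul_eq_C_mul]
  rcases n with _ | _ | n
  · simp
  · simp
    ring
  · simp only [derivative_X_pow, derivative_mul, derivative_C, Nat.add_sub_cancel]
    simp
    ring

theorem isClassicMultiplierSequence_quadratic_iff (A B C : ℝ) :
    IsClassicMultiplierSequence (fun n : ℕ => A * (n : ℝ) * ((n : ℝ) - 1) + B * (n : ℝ) + C) ↔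
      PreservesHyperbolicity (quadraticEulerOp A B C) := by
  constructor
  · rintro ⟨T, hT, h⟩
    have : T = quadraticEulerOp A B C := by
      refine (Polynomial.basisMonomials ℝ).ext fun n => ?_
      rw [h n]
      simp only [coe_basisMonomials, monomial_one_right_eq_X_pow, quadraticEulerOp_X_pow]
    rwa [← this]
  · refine fun h => ⟨_, h, fun n => ?_⟩
    simp only [coe_basisMonomials, monomial_one_right_eq_X_pow, quadraticEulerOp_X_pow]

theorem PreservesHyperbolicity.neg {T : ℝ[X] →ₗ[ℝ] ℝ[X]} (hT : PreservesHyperbolicity T) :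
    PreservesHyperbolicity (-T) := by
  intro f hf
  rcases hT f hf with h | h
  · exact Or.inl (by simp [h])
  · exact Or.inr fun z hz => h z (by simpa using hz)

theorem quadraticEulerOp_neg (A B C : ℝ) :
    quadraticEulerOp (-A) (-B) (-C) = -quadraticEulerOp A B C := by
  ext1 n
  ext1
  simp [quadraticEulerOp_apply]
  ring

/-! ### Sufficiency -/

/-- If `a • q' + b • q` vanishes and `a`, `b` are not both zero, then `q` is constant. -/
theorem derivative_eq_zero_of_combination_eq_zero {q : ℂ[X]} {a b : ℝ} (hab : a ≠ 0 ∨ b ≠ 0)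
    (h : Polynomial.C (a : ℂ) * derivative q + Polynomial.C (b : ℂ) * q = 0) :
    derivative q = 0 := by
  by_cases hb : b = 0
  · have ha : a ≠ 0 := hab.resolve_right (not_not_intro hb)
    simpa [hb, ha] using h
  · by_cases hq : q = 0
    · simp [hq]
    exfalso
    have h1 : (Polynomial.C (a : ℂ) * derivative q).degree < q.degree :=
      lt_of_le_of_lt (by
        rw [← smul_eq_C_mul]; exact degree_smul_le _ _) (degree_derivative_lt hq)
    have h2 : (Polynomial.C (b : ℂ) * q).degree = q.degree :=
      degree_C_mul (by exact_mod_cast hb)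
    have h3 := degree_add_eq_right_of_degree_lt (h1.trans_eq h2.symm)
    rw [h, h2, degree_zero] at h3
    exact hq (degree_eq_bot.1 h3.symm)

theorem Complex.multiset_sum_re_pos {s : Multiset ℂ} (hs : ∀ z ∈ s, 0 < z.re) (h0 : s ≠ 0) :
    0 < s.sum.re := by
  induction s using Multiset.induction with
  | empty => exact absurd rfl h0
  | cons z s ih =>
    rw [Multiset.sum_cons, Complex.add_re]
    have hz := hs z (Multiset.mem_cons_self z s)
    by_cases h : s = 0
    · simpa [h] using hz
    · exact add_pos hz (ih (fun w hw => hs w (Multiset.mem_cons_of_mem hw)) h)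

/-- A half-plane `0 < re (ω * u)` containing the positive reals and free of zeros of `p` is free of
zeros of `a • p' + b • p` when `a, b ≥ 0`. -/
theorem eval_combination_ne_zero {ω : ℂ} (hω : 0 < ω.re) {p : ℂ[X]} {a b : ℝ} (ha : 0 ≤ a)
    (hb : 0 ≤ b) (hp : ∀ u : ℂ, 0 < (ω * u).re → p.eval u ≠ 0)
    (h0 : Polynomial.C (a : ℂ) * derivative p + Polynomial.C (b : ℂ) * p ≠ 0)
    {u : ℂ} (hu : 0 < (ω * u).re) :
    (Polynomial.C (a : ℂ) * derivative p + Polynomial.C (b : ℂ) * p).eval u ≠ 0 := by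
  have hpu := hp u hu
  by_cases hd : p.natDegree = 0
  · obtain ⟨c, rfl⟩ := natDegree_eq_zero.1 hd
    rw [derivative_C, mul_zero, zero_add, ← C_mul] at h0 ⊢
    rw [eval_C]
    exact fun h => h0 (by rw [h, C_0])
  -- Here `p'/p = ∑ 1/(u - z)`, and each `ω(u - z)` has positive real part. A zero would give `a
  -- p'/p = -b`, hence `a = b = 0`.
  have hsum : 0 < (starRingEnd ℂ ω * (p.roots.map fun z => 1 / (u - z)).sum).re := by
    rw [← Multiset.sum_map_mul_left]
    refine Complex.multiset_sum_re_pos (fun w hw => ?_) ?_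
    · obtain ⟨z, hz, rfl⟩ := Multiset.mem_map.1 hw
      have hz0 : (ω * z).re ≤ 0 := not_lt.1 fun h => hp z h (mem_roots'.1 hz).2
      have h1 : 0 < (ω * (u - z)).re := by
        rw [mul_sub, Complex.sub_re]
        linarith
      have h2 : u - z ≠ 0 := fun h => by simp [h] at h1
      have h3 : (starRingEnd ℂ ω * (1 / (u - z))).re
          = (ω * (u - z)).re / Complex.normSq (u - z) := by
        simp [Complex.inv_re, Complex.inv_im, div_eq_mul_inv]
        ring
      rw [h3]
      exact div_pos h1 (Complex.normSq_pos.2 h2)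
    · rw [Ne, Multiset.map_eq_zero, ← Multiset.card_eq_zero,
        ← (IsAlgClosed.splits p).natDegree_eq_card_roots]
      exact hd
  rw [← (IsAlgClosed.splits p).eval_derivative_div_eval_of_ne_zero hpu] at hsum
  intro h
  rw [eval_add, eval_mul, eval_mul, eval_C, eval_C] at h
  have h1 : (a : ℂ) * ((derivative p).eval u / p.eval u) = -(b : ℂ) := by
    field_simp
    linear_combination h
  have h2 : a * (starRingEnd ℂ ω * ((derivative p).eval u / p.eval u)).re = -(b * ω.re) := by
    rw [← Complex.re_ofReal_mul, mul_left_comm, h1]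
    simp [mul_comm]
  have h3 : a = 0 := by
    by_contra ha0
    have := mul_pos (ha.lt_of_ne' ha0) hsum
    have := mul_nonneg hb hω.le
    linarith
  have h4 : b = 0 := by
    rw [h3, zero_mul, zero_eq_neg] at h2
    exact (mul_eq_zero.1 h2).resolve_right hω.ne'
  exact h0 (by simp [h3, h4])

/-- A real polynomial of degree at most one is hyperbolic. -/
theorem isHyperbolic_linear (a b : ℝ) :
    IsHyperbolic (Polynomial.C a * X + Polynomial.C b) := by
  by_cases ha : a = 0
  · by_cases hb : b = 0
    · exact Or.inl (by simp [ha, hb])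
    · exact Or.inr fun z hz => by simp [ha, hb] at hz
  · refine Or.inr fun z hz => ?_
    have := congrArg Complex.im hz
    simpa [ha] using this

theorem preservesHyperbolicity_of_factorization {a b c d : ℝ} (ha : 0 ≤ a) (hb : 0 ≤ b)
    (hc : 0 ≤ c) (hd : 0 ≤ d) (hab : a ≠ 0 ∨ b ≠ 0) (hcd : c ≠ 0 ∨ d ≠ 0) :
    PreservesHyperbolicity (quadraticEulerOp (a * c) (a * d + b * c) (b * d)) := by
  intro f hf
  -- If `f'' ≠ 0`, neither first-order factor can produce the zero polynomial.
  by_cases hf2 : derivative (derivative f) = 0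
  · have h1 : f.natDegree ≤ 1 := by
      have := derivative_eq_zero.1 hf2
      by_contra! h
      have h2 := natDegree_derivative f
      omega
    obtain ⟨p, q, rfl⟩ := exists_eq_X_add_C_of_natDegree_le_one h1
    convert isHyperbolic_linear ((a * d + b * c + b * d) * p) (b * d * q) using 1
    simp [quadraticEulerOp_apply]
    ring
  have hf : ∀ z : ℂ, aeval z f = 0 → z.im = 0 := hf.resolve_left (by rintro rfl; simp at hf2)
  refine Or.inr fun x hx => ?_
  by_contra him
  set F : ℂ[X] := f.map (algebraMap ℝ ℂ) with hF
  set g : ℂ[X] := F.comp (Polynomial.C x * X) with hg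
  have hx0 : x ≠ 0 := by rintro rfl; simp at him
  -- Chosen so that `re (ω u) = im x * im (x u)`: the half-plane contains `u = 1` and avoids the
  -- zeros of `g`.
  set ω : ℂ := -Complex.I * x * x.im with hωd
  have hω : 0 < ω.re := by
    have : ω.re = x.im ^ 2 := by simp [hωd]; ring
    rw [this]; positivity
  have hgz : ∀ u : ℂ, 0 < (ω * u).re → g.eval u ≠ 0 := by
    intro u hu h
    have h1 : aeval (x * u) f = 0 := by
      simpa [hg, hF, eval_map_algebraMap] using h
    have h2 := hf _ h1
    have h3 : (ω * u).re = x.im * (x * u).im := by simp [hωd]; ring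
    rw [h3, h2] at hu
    simp at hu
  have hg1 : derivative g = Polynomial.C x * (derivative F).comp (Polynomial.C x * X) := by
    simp [hg, derivative_comp]
  have hg2 : derivative (derivative g)
      = Polynomial.C (x ^ 2) * (derivative (derivative F)).comp (Polynomial.C x * X) := by
    rw [hg1]
    simp [derivative_comp]
    ring
  have hg2' : derivative (derivative g) ≠ 0 := by
    rw [hg2]
    refine mul_ne_zero (by simp [hx0]) fun h => ?_
    have h1 := congrArg (fun p => p.comp (Polynomial.C x⁻¹ * X)) h
    simp only [comp_assoc] at h1
    rw [hF, derivative_map, derivative_map] at h1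
    simp only [mul_comp, C_comp, X_comp, ← mul_assoc, ← C_mul, mul_inv_cancel₀ hx0, C_1, one_mul,
      comp_X, zero_comp] at h1
    exact hf2 ((Polynomial.map_eq_zero _).1 h1)
  set h : ℂ[X] := Polynomial.C (a : ℂ) * derivative g + Polynomial.C (b : ℂ) * g with hh
  set H : ℂ[X] := Polynomial.C (c : ℂ) * derivative h + Polynomial.C (d : ℂ) * h with hH
  have hh0 : h ≠ 0 := fun e =>
    hg2' (by rw [derivative_eq_zero_of_combination_eq_zero hab e, derivative_zero])
  have hH0 : H ≠ 0 := fun e => by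
    have h1 := derivative_eq_zero_of_combination_eq_zero hcd e
    refine hg2' (derivative_eq_zero_of_combination_eq_zero hab ?_)
    rw [← h1, hh]
    simp
  refine eval_combination_ne_zero hω hc hd (fun u hu => eval_combination_ne_zero hω ha hb hgz hh0 hu)
    hH0 (u := 1) (by simpa using hω) ?_
  rw [← hx, quadraticEulerOp_apply]
  simp only [derivative_add, derivative_C_mul]
  rw [hg2, hg1]
  simp [hg, hF, derivative_map, eval_map_algebraMap, aeval_def]
  ring

theorem preservesHyperbolicity_of_nonneg {A B C : ℝ} (hA : 0 ≤ A) (hB : 0 ≤ B) (hC : 0 ≤ C)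
    (hD : 0 ≤ B ^ 2 - 4 * A * C) : PreservesHyperbolicity (quadraticEulerOp A B C) := by
  rcases hA.eq_or_lt with rfl | hA
  · by_cases hBC : B = 0 ∧ C = 0
    · obtain ⟨rfl, rfl⟩ := hBC
      exact fun f _ => Or.inl (by simp [quadraticEulerOp_apply])
    · have := preservesHyperbolicity_of_factorization hB hC le_rfl zero_le_one
        (by tauto) (Or.inr one_ne_zero)
      simpa using this
  · have hs := Real.sq_sqrt hD
    set s := √(B ^ 2 - 4 * A * C)
    have hs0 : 0 ≤ s := Real.sqrt_nonneg _
    have hsB : s ≤ B := abs_le_of_sq_le_sq' (by nlinarith [mul_nonneg hA.le hC]) hB |>.2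
    -- `A t² + B t + C = (A t + (B + s)/2)(t + (B - s)/(2A))`.
    have := preservesHyperbolicity_of_factorization (a := A) (b := (B + s) / 2) (c := 1)
      (d := (B - s) / (2 * A)) hA.le (by positivity) zero_le_one
      (div_nonneg (by linarith) (by positivity)) (Or.inl hA.ne') (Or.inl one_ne_zero)
    convert this using 2
    · ring
    · field_simp
      ring
    · field_simp
      linarith

/-! ### Necessity -/

theorem IsHyperbolic.im_eq_zero_of_aeval_right {f g : ℝ[X]} (h : IsHyperbolic (f * g)) (hf : f ≠ 0)
    (hg : g ≠ 0) {z : ℂ} (hz : aeval z g = 0) : z.im = 0 :=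
  h.resolve_left (mul_ne_zero hf hg) z (by simp [hz])

theorem IsHyperbolic.X_pow_mul {k : ℕ} {f : ℝ[X]} (h : IsHyperbolic f) :
    IsHyperbolic (X ^ k * f) := by
  rcases h with rfl | h
  · exact Or.inl (by simp)
  · refine Or.inr fun z hz => ?_
    rw [map_mul, map_pow, aeval_X, mul_eq_zero] at hz
    rcases hz with hz | hz
    · simp [eq_zero_of_pow_eq_zero hz]
    · exact h z hz

/-- An even polynomial with a negative zero in `x²` has a nonreal zero. -/
theorem not_isHyperbolic_even {k : ℕ} {a b c y : ℝ} (hy : y < 0)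
    (h0 : a * y ^ 2 + b * y + c = 0) (hc : c ≠ 0) :
    ¬ IsHyperbolic (X ^ k * (Polynomial.C a * X ^ 4 + Polynomial.C b * X ^ 2 + Polynomial.C c)) := by
  intro h
  have hz : ((√(-y) : ℝ) * Complex.I) ^ 2 = (y : ℂ) := by
    rw [mul_pow, Complex.I_sq, ← Complex.ofReal_pow, Real.sq_sqrt (by linarith)]
    simp
  have := h.im_eq_zero_of_aeval_right (z := (√(-y) : ℝ) * Complex.I) (pow_ne_zero _ X_ne_zero) (by
    intro e
    have := congrArg (eval 0) e
    simp [hc] at this) (by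
    have h4 : ((√(-y) : ℝ) * Complex.I) ^ 4 = (y : ℂ) ^ 2 := by rw [← hz]; ring
    simp only [map_add, map_mul, aeval_C, map_pow, aeval_X, h4, hz]
    simpa using congrArg (algebraMap ℝ ℂ) h0)
  simp at this
  exact absurd this (Real.sqrt_pos.2 (by linarith)).ne'

/-- A real quadratic polynomial with negative discriminant is not hyperbolic. -/
theorem not_isHyperbolic_of_discrim_neg {f : ℝ[X]} (hf : f ≠ 0) {a b c : ℝ}
    (hd : b ^ 2 - 4 * a * c < 0) :
    ¬ IsHyperbolic (f * (Polynomial.C a * X ^ 2 + Polynomial.C b * X + Polynomial.C c)) := by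
  intro h
  have ha : a ≠ 0 := by rintro rfl; nlinarith
  have hc : c ≠ 0 := by rintro rfl; nlinarith
  set s := √(4 * a * c - b ^ 2) with hsd
  have hs : 0 < s := Real.sqrt_pos.2 (by linarith)
  have hs2 : s ^ 2 = 4 * a * c - b ^ 2 := Real.sq_sqrt (by linarith)
  have hs2' : (s : ℂ) ^ 2 = 4 * a * c - b ^ 2 := by exact_mod_cast hs2
  have haC : (a : ℂ) ≠ 0 := by exact_mod_cast ha
  have := h.im_eq_zero_of_aeval_right (z := ((-b / (2 * a) : ℝ) : ℂ) + ((s / (2 * a) : ℝ) : ℂ) * Complex.I)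
    hf (by
      intro e
      have := congrArg (eval 0) e
      simp [hc] at this) (by
      simp only [map_add, map_mul, aeval_C, map_pow, aeval_X]
      simp
      field_simp
      ring_nf
      simp only [Complex.I_sq, hs2']
      ring)
  rw [Complex.add_im, Complex.ofReal_im, zero_add, Complex.im_ofReal_mul, Complex.I_im, mul_one,
    div_eq_zero_iff] at this
  rcases this with h | h
  · exact hs.ne' h
  · exact ha (by linarith)

/-! ### Necessary conditions from test polynomials. -/

section Coefficients

variable {A B C : ℝ}

theorem coeff_two_nonpos (hT : PreservesHyperbolicity (quadraticEulerOp A B C)) {k : ℕ}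
    (hk : A * (k : ℝ) * ((k : ℝ) - 1) + B * (k : ℝ) + C < 0) :
    A * (k + 2 : ℝ) * ((k + 2 : ℝ) - 1) + B * (k + 2 : ℝ) + C ≤ 0 := by
  by_contra! h
  have h1 := hT _ (IsHyperbolic.X_pow_mul (k := k) (f := X ^ 2 - 1) (Or.inr fun z hz => by
    have : (z - 1) * (z + 1) = 0 := by simp at hz; linear_combination hz
    rcases mul_eq_zero.1 this with h | h
    · simp [sub_eq_zero.1 h]
    · simp [eq_neg_of_add_eq_zero_left h]))
  rw [mul_sub, mul_one, ← pow_add, map_sub, quadraticEulerOp_X_pow, quadraticEulerOp_X_pow] at h1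
  push_cast at h1
  set a := A * (k : ℝ) * ((k : ℝ) - 1) + B * (k : ℝ) + C
  set c := A * (k + 2 : ℝ) * ((k + 2 : ℝ) - 1) + B * (k + 2 : ℝ) + C
  refine not_isHyperbolic_even (k := k) (a := 0) (b := c) (c := -a) (y := a / c)
    (div_neg_of_neg_of_pos hk h) (by field_simp; ring) (by linarith) ?_
  convert h1 using 1
  simp only [smul_eq_C_mul, C_neg, C_0]
  ring

/-- Test polynomial `x^k (x² - 1)(x² - 4)`: outer coefficients of opposite signs give the image a
negative root in `x²`. -/
theorem coeff_four_nonpos (hT : PreservesHyperbolicity (quadraticEulerOp A B C)) {k : ℕ}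
    (hk : A * (k : ℝ) * ((k : ℝ) - 1) + B * (k : ℝ) + C < 0) :
    A * (k + 4 : ℝ) * ((k + 4 : ℝ) - 1) + B * (k + 4 : ℝ) + C ≤ 0 := by
  by_contra! h
  have h1 := hT _ (IsHyperbolic.X_pow_mul (k := k)
    (f := X ^ 4 - (5 : ℝ) • X ^ 2 + (4 : ℝ) • 1) (Or.inr fun z hz => by
    have : ((z - 1) * (z + 1)) * ((z - 2) * (z + 2)) = 0 := by
      simp at hz
      linear_combination hz
    rcases mul_eq_zero.1 this with h | h <;> rcases mul_eq_zero.1 h with h | h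
    · simp [sub_eq_zero.1 h]
    · simp [eq_neg_of_add_eq_zero_left h]
    · simp [sub_eq_zero.1 h]
    · simp [eq_neg_of_add_eq_zero_left h]))
  rw [mul_add, mul_sub, mul_smul_comm, mul_smul_comm, mul_one, ← pow_add, ← pow_add, map_add,
    map_sub, map_smul, map_smul, quadraticEulerOp_X_pow, quadraticEulerOp_X_pow,
    quadraticEulerOp_X_pow] at h1
  push_cast at h1
  set a := A * (k : ℝ) * ((k : ℝ) - 1) + B * (k : ℝ) + C
  set b := A * (k + 2 : ℝ) * ((k + 2 : ℝ) - 1) + B * (k + 2 : ℝ) + C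
  set c := A * (k + 4 : ℝ) * ((k + 4 : ℝ) - 1) + B * (k + 4 : ℝ) + C
  have hca : c * a < 0 := mul_neg_of_pos_of_neg h hk
  have hs2 : √(25 * b ^ 2 - 16 * c * a) ^ 2 = 25 * b ^ 2 - 16 * c * a :=
    Real.sq_sqrt (by nlinarith [sq_nonneg b])
  have hs0 := Real.sqrt_nonneg (25 * b ^ 2 - 16 * c * a)
  set s := √(25 * b ^ 2 - 16 * c * a)
  have hs : 5 * b < s := lt_of_pow_lt_pow_left₀ 2 hs0 (by nlinarith)
  refine not_isHyperbolic_even (k := k) (a := c) (b := -5 * b) (c := 4 * a)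
    (y := (5 * b - s) / (2 * c)) (div_neg_of_neg_of_pos (by linarith) (by linarith))
    (by field_simp; linear_combination hs2) (by linarith) ?_
  convert h1 using 1
  simp only [smul_eq_C_mul, C_mul, C_neg]
  simp
  ring

theorem coeff_nonneg (hT : PreservesHyperbolicity (quadraticEulerOp A B C)) (hA : 0 ≤ A)
    (hAB : 0 < A ∨ 0 < B) (k : ℕ) : 0 ≤ A * (k : ℝ) * ((k : ℝ) - 1) + B * (k : ℝ) + C := by
  by_contra! hk
  have key : ∀ j : ℕ, A * (k + 2 * j : ℝ) * ((k + 2 * j : ℝ) - 1) + B * (k + 2 * j : ℝ) + C < 0 := by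
    intro j
    induction j with
    | zero => simpa using hk
    | succ j ih =>
      have h4 := coeff_four_nonpos hT (k := k + 2 * j) (by push_cast; exact ih)
      push_cast at h4 ⊢
      -- Convexity (`A ≥ 0`): the value at the midpoint `k + 2j + 2` is at most the mean of a
      -- negative and a nonpositive number.
      nlinarith
  -- The sequence is eventually positive, contradicting `key`.
  rcases hAB with hA' | hB
  · obtain ⟨j, hj⟩ := exists_nat_gt ((|B| + |C|) / A + 1)
    have h1 := key j
    have hj1 : (|B| + |C|) / A < k + 2 * j - 1 := by
      have : (0 : ℝ) ≤ k := k.cast_nonneg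
      have : (0 : ℝ) ≤ j := j.cast_nonneg
      linarith
    have hm : (0 : ℝ) ≤ k + 2 * j - 1 := le_trans (by positivity) hj1.le
    rw [div_lt_iff₀ hA'] at hj1
    set m : ℝ := k + 2 * j
    have h2 : 0 ≤ A * (m - 1) + B - |C| := by linarith [neg_abs_le B]
    nlinarith [mul_nonneg h2 hm, neg_abs_le C, mul_nonneg (abs_nonneg C) hm]
  · obtain ⟨j, hj⟩ := exists_nat_gt (|C| / B + 1)
    have h1 := key j
    have hj1 : |C| / B < k + 2 * j - 1 := by
      have : (0 : ℝ) ≤ k := k.cast_nonneg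
      have : (0 : ℝ) ≤ j := j.cast_nonneg
      linarith
    have hm : (0 : ℝ) ≤ k + 2 * j - 1 := le_trans (by positivity) hj1.le
    rw [div_lt_iff₀ hB] at hj1
    set m : ℝ := k + 2 * j
    have h2 : 0 ≤ A * m * (m - 1) := mul_nonneg (mul_nonneg hA (by linarith)) hm
    linarith [neg_abs_le C]

/-- With `N = n + 2`, the image of `(1 + x)^N` is `(1 + x)^n` times a quadratic of discriminant `N
(N (B² - 4AC) + 4AC)`; then `N → ∞`. -/
theorem discrim_nonneg (hT : PreservesHyperbolicity (quadraticEulerOp A B C)) :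
    0 ≤ B ^ 2 - 4 * A * C := by
  have hone : (1 + X : ℝ[X]) ≠ 0 := fun e => by
    have := congrArg (eval 0) e
    simp at this
  have key : ∀ n : ℕ, 0 ≤ (n + 2 : ℝ) * (B ^ 2 - 4 * A * C) + 4 * A * C := by
    intro n
    by_contra! hneg
    have h := hT ((1 + X) ^ (n + 2)) (Or.inr fun z hz => by
      have : 1 + z = 0 := eq_zero_of_pow_eq_zero (n := n + 2) (by simpa only [map_pow, map_add, map_one, aeval_X] using hz)
      simp [eq_neg_of_add_eq_zero_right this])
    refine not_isHyperbolic_of_discrim_neg (f := (1 + X) ^ n) (pow_ne_zero _ hone)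
      (a := A * (n + 2) * (n + 1) + B * (n + 2) + C) (b := B * (n + 2) + 2 * C) (c := C) ?_ ?_
    · nlinarith [mul_neg_of_pos_of_neg (by positivity : (0 : ℝ) < n + 2) hneg]
    · convert h using 1
      rw [quadraticEulerOp_apply]
      have h2 : (Polynomial.C 2 : ℝ[X]) = 2 := rfl
      simp [derivative_pow, h2]
      ring
  by_contra! hneg
  obtain ⟨n, hn⟩ := exists_nat_gt (4 * A * C / -(B ^ 2 - 4 * A * C))
  rw [div_lt_iff₀ (by linarith)] at hn
  nlinarith [key n]

theorem nonneg_of_preservesHyperbolicity (hT : PreservesHyperbolicity (quadraticEulerOp A B C))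
    (hA : 0 ≤ A) (hAB : 0 < A ∨ 0 < B) : 0 ≤ A ∧ 0 ≤ B ∧ 0 ≤ C := by
  have hcoeff := coeff_nonneg hT hA hAB
  have hC : 0 ≤ C := by simpa using hcoeff 0
  refine ⟨hA, ?_, hC⟩
  rcases hAB with hA | hB
  · by_contra! hB
    have hD := discrim_nonneg hT
    -- `n + 1` lies within `1/2` of the vertex of `A t (t - 1) + B t + C`, so the value there is at
    -- most `C - B²/(4A) + B/2 < 0`.
    set n := ⌊-B / (2 * A)⌋₊
    have h1 : (n : ℝ) ≤ -B / (2 * A) := Nat.floor_le (div_nonneg (by linarith) (by linarith))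
    have h2 : -B / (2 * A) < n + 1 := Nat.lt_floor_add_one _
    rw [le_div_iff₀ (by linarith)] at h1
    rw [div_lt_iff₀ (by linarith)] at h2
    have h3 := hcoeff (n + 1)
    push_cast at h3
    nlinarith [mul_nonneg h3 hA.le]
  · exact hB.le

end Coefficients

theorem sameSign_of_preservesHyperbolicity {A B C : ℝ}
    (hT : PreservesHyperbolicity (quadraticEulerOp A B C)) : SameSign A B C := by
  -- The sign of `A`, or of `B` when `A = 0`, decides; negation swaps the two cases.
  by_cases hpos : 0 ≤ A ∧ (0 < A ∨ 0 < B)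
  · exact Or.inl (nonneg_of_preservesHyperbolicity hT hpos.1 hpos.2)
  by_cases hneg : A ≤ 0 ∧ (A < 0 ∨ B < 0)
  · have := nonneg_of_preservesHyperbolicity (quadraticEulerOp_neg A B C ▸ hT.neg)
      (by linarith [hneg.1]) (by simpa using hneg.2)
    exact Or.inr ⟨by linarith [this.1], by linarith [this.2.1], by linarith [this.2.2]⟩
  have hA : A = 0 := by
    rcases lt_trichotomy A 0 with h | h | h
    · exact absurd ⟨h.le, Or.inl h⟩ hneg
    · exact h
    · exact absurd ⟨h.le, Or.inl h⟩ hpos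
  have hB : B = 0 := by
    rcases lt_trichotomy B 0 with h | h | h
    · exact absurd ⟨hA.le, Or.inr h⟩ hneg
    · exact h
    · exact absurd ⟨hA.ge, Or.inr h⟩ hpos
  rcases le_total 0 C with hC | hC
  · exact Or.inl ⟨hA.ge, hB.ge, hC⟩
  · exact Or.inr ⟨hA.le, hB.le, hC⟩

theorem mainTheorem8 (A B C : ℝ) :
    IsClassicMultiplierSequence (fun n : ℕ => A * (n : ℝ) * ((n : ℝ) - 1) + B * (n : ℝ) + C) ↔
      SameSign A B C ∧ 0 ≤ B ^ 2 - 4 * A * C := by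
  rw [isClassicMultiplierSequence_quadratic_iff]
  refine ⟨fun hT => ⟨sameSign_of_preservesHyperbolicity hT, discrim_nonneg hT⟩, ?_⟩
  rintro ⟨⟨hA, hB, hC⟩ | ⟨hA, hB, hC⟩, hD⟩
  · exact preservesHyperbolicity_of_nonneg hA hB hC hD
  · have := (preservesHyperbolicity_of_nonneg (A := -A) (B := -B) (C := -C) (by linarith)
      (by linarith) (by linarith) (by linarith)).neg
    rwa [quadraticEulerOp_neg, neg_neg] at this
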